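/- Let $\mathfrak{M}(\mathbb{C}^n)$ be the field of meromorphic functions on $\mathbb{C}^n$. For $f \in \mathfrak{M}(\mathbb{C}^n)$ let $\Gamma_f = \{\gamma \in \mathbb{C}^n : f(z+\gamma) = f(z) \text{ as meromorphic functions of } z\}$ be its period group, and for a subfield $K$ let $\Gamma_K = \bigcap_{f\in K}\Gamma_f$. Call $K$ non-degenerate if $\Gamma_K$ is a discrete subgroup of $\mathbb{C}^n$ (in particular this holds if $\Gamma_f$ is discrete for some $f \in K$). An isogeny between complex Lie groups $\mathbb{C}^n/\Gamma$ and $\mathbb{C}^m/\Gamma'$ with $\Gamma$, $\Gamma'$ discrete is a surjective holomorphic group homomorphism with finite kernel. Let $K_1 \subset K_2$ be subfields of $\mathfrak{M}(\mathbb{C}^n)$ which contain $\mathbb{C}$ and are finitely generated over $\mathbb{C}$. Assume that $K_1$ is non-degenerate and that $K_1$ and $K_2$ have the same transcendence degree over $\mathbb{C}$. Then $\Gamma_{K_1}$ and $\Gamma_{K_2}$ are discrete, $\Gamma_{K_2} \subset \Gamma_{K_1}$, and the identity map of $\mathbb{C}^n$ induces an isogeny $\varphi : \mathbb{C}^n/\Gamma_{K_2}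 \to \mathbb{C}^n/\Gamma_{K_1}$; that is, $\varphi(z + \Gamma_{K_2}) = z + \Gamma_{K_1}$ is well defined, holomorphic, a surjective homomorphism, and has finite kernel. In particular $\Gamma_{K_1}/\Gamma_{K_2}$ is finite. -/

import Mathlib

open Filter Topology

noncomputable section

/-! ### Meromorphic functions on `ℂⁿ` -/

/-- Near the point `p` the function `f` is the quotient `g / h` of two holomorphic functions, where
`h` does not vanish identically near `p`. -/
structure IsLocalQuotient {n : ℕ} (f g h : (Fin n → ℂ) → ℂ) (p : Fin n → ℂ) : Prop where
  num : AnalyticAt ℂ g p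
  den : AnalyticAt ℂ h p
  den_ne : ¬ h =ᶠ[𝓝 p] 0
  eq_div : ∀ᶠ z in 𝓝 p, h z ≠ 0 → f z = g z / h z

/-- `f` represents a meromorphic function on `ℂⁿ`: near every point it is a quotient of two
holomorphic functions (its values at the zeros of the denominators are irrelevant). -/
def IsMeromorphicFun {n : ℕ} (f : (Fin n → ℂ) → ℂ) : Prop :=
  ∀ p, ∃ g h, IsLocalQuotient f g h p

/-- The filter of all sets that contain a dense open set. -/
def denseOpenFilter (n : ℕ) : Filter (Fin n → ℂ) where
  sets := {s | Dense (interior s)}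
  univ_sets := by simp
  sets_of_superset h hst := h.mono (interior_mono hst)
  inter_sets {s t} hs ht := by
    simp only [Set.mem_ofPred_eq] at *
    rw [interior_inter]
    exact hs.inter_of_isOpen_left ht isOpen_interior

theorem mem_denseOpenFilter {n : ℕ} {s : Set (Fin n → ℂ)} :
    s ∈ denseOpenFilter n ↔ Dense (interior s) := Iff.rfl

instance denseOpenFilter_neBot (n : ℕ) : (denseOpenFilter n).NeBot := by
  refine ⟨fun h => ?_⟩
  have h0 : (∅ : Set (Fin n → ℂ)) ∈ denseOpenFilter n := by rw [h]; exact mem_bot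
  rw [mem_denseOpenFilter, interior_empty] at h0
  exact h0.nonempty.ne_empty rfl

theorem eventually_not_eventuallyEq_zero {n : ℕ} {h : (Fin n → ℂ) → ℂ} {p : Fin n → ℂ}
    (ha : AnalyticAt ℂ h p) (h0 : ¬ h =ᶠ[𝓝 p] 0) :
    ∀ᶠ z in 𝓝 p, AnalyticAt ℂ h z ∧ ¬ h =ᶠ[𝓝 z] 0 := by
  obtain ⟨r, hr, hball⟩ := Metric.eventually_nhds_iff_ball.1 ha.eventually_analyticAt
  refine Metric.eventually_nhds_iff_ball.2 ⟨r, hr, fun z hz => ⟨hball z hz, fun hz0 => h0 ?_⟩⟩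
  have hE : Set.EqOn h 0 (Metric.ball p r) :=
    AnalyticOnNhd.eqOn_zero_of_preconnected_of_eventuallyEq_zero (fun w hw => hball w hw)
      (convex_ball p r).isPreconnected hz hz0
  filter_upwards [Metric.ball_mem_nhds p hr] with w hw using hE hw

theorem mul_not_eventuallyEq_zero {n : ℕ} {g h : (Fin n → ℂ) → ℂ} {p : Fin n → ℂ}
    (ga : AnalyticAt ℂ g p) (ha : AnalyticAt ℂ h p)
    (g0 : ¬ g =ᶠ[𝓝 p] 0) (h0 : ¬ h =ᶠ[𝓝 p] 0) : ¬ (g * h) =ᶠ[𝓝 p] 0 := by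
  intro hgh
  have hf : ∃ᶠ z in 𝓝 p, h z ≠ 0 := not_eventually.1 h0
  obtain ⟨z, hz, ⟨_, gz⟩, ⟨haz, _⟩, hghz⟩ := (hf.and_eventually
    ((eventually_not_eventuallyEq_zero ga g0).and
      ((eventually_not_eventuallyEq_zero ha h0).and hgh.eventually_nhds))).exists
  apply gz
  filter_upwards [hghz, haz.continuousAt.eventually_ne hz] with w hw hw'
  exact (mul_eq_zero.1 hw).resolve_right hw'

theorem eventually_denseOpenFilter {n : ℕ} {P : (Fin n → ℂ) → Prop}
    (hP : ∀ p, ∃ h : (Fin n → ℂ) → ℂ, AnalyticAt ℂ h p ∧ ¬ h =ᶠ[𝓝 p] 0 ∧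
      ∀ᶠ z in 𝓝 p, h z ≠ 0 → P z) :
    ∀ᶠ z in denseOpenFilter n, P z := by
  change Dense (interior {z | P z})
  intro p
  rw [mem_closure_iff_frequently]
  obtain ⟨h, ha, h0, hev⟩ := hP p
  have hf : ∃ᶠ z in 𝓝 p, h z ≠ 0 := not_eventually.1 h0
  refine (hf.and_eventually (ha.eventually_analyticAt.and hev.eventually_nhds)).mono ?_
  rintro z ⟨hz, haz, hevz⟩
  rw [mem_interior_iff_mem_nhds]
  filter_upwards [hevz, haz.continuousAt.eventually_ne hz] with w hw hw' using hw hw'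

namespace IsLocalQuotient

variable {n : ℕ} {f f' g g' h h' : (Fin n → ℂ) → ℂ} {p : Fin n → ℂ}

theorem add (H : IsLocalQuotient f g h p) (H' : IsLocalQuotient f' g' h' p) :
    IsLocalQuotient (f + f') (g * h' + h * g') (h * h') p where
  num := (H.num.mul H'.den).add (H.den.mul H'.num)
  den := H.den.mul H'.den
  den_ne := mul_not_eventuallyEq_zero H.den H'.den H.den_ne H'.den_ne
  eq_div := by
    filter_upwards [H.eq_div, H'.eq_div] with z hz hz' hne
    obtain ⟨h1, h2⟩ := mul_ne_zero_iff.1 hne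
    simp only [Pi.add_apply, Pi.mul_apply, hz h1, hz' h2, div_add_div _ _ h1 h2]

theorem mul (H : IsLocalQuotient f g h p) (H' : IsLocalQuotient f' g' h' p) :
    IsLocalQuotient (f * f') (g * g') (h * h') p where
  num := H.num.mul H'.num
  den := H.den.mul H'.den
  den_ne := mul_not_eventuallyEq_zero H.den H'.den H.den_ne H'.den_ne
  eq_div := by
    filter_upwards [H.eq_div, H'.eq_div] with z hz hz' hne
    obtain ⟨h1, h2⟩ := mul_ne_zero_iff.1 hne
    simp only [Pi.mul_apply, hz h1, hz' h2, div_mul_div_comm]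

theorem neg (H : IsLocalQuotient f g h p) : IsLocalQuotient (-f) (-g) h p where
  num := H.num.neg
  den := H.den
  den_ne := H.den_ne
  eq_div := by
    filter_upwards [H.eq_div] with z hz hne
    simp only [Pi.neg_apply, hz hne, neg_div]

theorem inv (H : IsLocalQuotient f g h p) (g0 : ¬ g =ᶠ[𝓝 p] 0) :
    IsLocalQuotient f⁻¹ (h * h) (g * h) p where
  num := H.den.mul H.den
  den := H.num.mul H.den
  den_ne := mul_not_eventuallyEq_zero H.num H.den g0 H.den_ne
  eq_div := by
    filter_upwards [H.eq_div] with z hz hne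
    obtain ⟨h1, h2⟩ := mul_ne_zero_iff.1 hne
    simp only [Pi.mul_apply, Pi.inv_apply, hz h2]
    field_simp

theorem const (c : ℂ) (p : Fin n → ℂ) :
    IsLocalQuotient (fun _ : Fin n → ℂ => c) (fun _ => c) (fun _ => 1) p where
  num := analyticAt_const
  den := analyticAt_const
  den_ne h0 := one_ne_zero (α := ℂ) (h0.self_of_nhds)
  eq_div := by simp

theorem eventually_nhds (H : IsLocalQuotient f g h p) :
    ∀ᶠ q in 𝓝 p, IsLocalQuotient f g h q := by
  filter_upwards [H.num.eventually_analyticAt, eventually_not_eventuallyEq_zero H.den H.den_ne,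
    H.eq_div.eventually_nhds] with q h1 h2 h3 using ⟨h1, h2.1, h2.2, h3⟩

theorem num_eq_zero (H : IsLocalQuotient f g h p) (H' : IsLocalQuotient f g' h' p)
    (g0 : g =ᶠ[𝓝 p] 0) : g' =ᶠ[𝓝 p] 0 := by
  by_contra g0'
  refine mul_not_eventuallyEq_zero (H'.num.mul H.den) H'.den
    (mul_not_eventuallyEq_zero H'.num H.den g0' H.den_ne) H'.den_ne ?_
  filter_upwards [H.eq_div, H'.eq_div, g0] with z h1 h2 h3
  simp only [Pi.mul_apply, Pi.zero_apply] at *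
  by_cases hz : h z = 0
  · simp [hz]
  by_cases hz' : h' z = 0
  · simp [hz']
  have h4 := h2 hz'
  rw [h1 hz, h3, zero_div, eq_comm, div_eq_zero_iff] at h4
  simp [h4.resolve_right hz']

end IsLocalQuotient

/-- Identity theorem: a meromorphic function on `ℂⁿ` that is not zero vanishes nowhere locally. -/
theorem IsMeromorphicFun.num_ne_zero {n : ℕ} {f : (Fin n → ℂ) → ℂ} (hf : IsMeromorphicFun f)
    (f0 : ¬ f =ᶠ[denseOpenFilter n] 0) {g h : (Fin n → ℂ) → ℂ} {p : Fin n → ℂ}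
    (H : IsLocalQuotient f g h p) : ¬ g =ᶠ[𝓝 p] 0 := by
  intro g0
  apply f0
  have hopen : IsOpen {q | ∃ g h, IsLocalQuotient f g h q ∧ g =ᶠ[𝓝 q] 0} := by
    rw [isOpen_iff_mem_nhds]
    rintro q ⟨g, h, Hq, gq⟩
    filter_upwards [Hq.eventually_nhds, gq.eventually_nhds] with w h1 h2 using ⟨g, h, h1, h2⟩
  have hclosed : IsClosed {q | ∃ g h, IsLocalQuotient f g h q ∧ g =ᶠ[𝓝 q] 0} := by
    rw [← isOpen_compl_iff, isOpen_iff_mem_nhds]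
    intro q hq
    obtain ⟨g, h, Hq⟩ := hf q
    have gq : ¬ g =ᶠ[𝓝 q] 0 := fun hg => hq ⟨g, h, Hq, hg⟩
    filter_upwards [Hq.eventually_nhds, eventually_not_eventuallyEq_zero Hq.num gq] with w h1 h2
    rintro ⟨g', h', H', g0'⟩
    exact h2.2 (H'.num_eq_zero h1 g0')
  have huniv := IsClopen.eq_univ ⟨hclosed, hopen⟩ ⟨p, g, h, H, g0⟩
  refine eventually_denseOpenFilter fun q => ?_
  obtain ⟨g, h, Hq, gq⟩ := huniv.ge (Set.mem_univ q)
  refine ⟨h, Hq.den, Hq.den_ne, ?_⟩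
  filter_upwards [Hq.eq_div, gq] with z h1 h2 hz
  rw [h1 hz, h2]
  simp

/-- The meromorphic functions on `ℂⁿ`, where two functions that agree on a dense open set are
identified, as a ring. -/
def meromorphicSubring (n : ℕ) : Subring ((denseOpenFilter n).Germ ℂ) where
  carrier := {φ | ∃ f : (Fin n → ℂ) → ℂ, IsMeromorphicFun f ∧ (f : (denseOpenFilter n).Germ ℂ) = φ}
  zero_mem' := ⟨fun _ => 0, fun p => ⟨_, _, .const 0 p⟩, rfl⟩
  one_mem' := ⟨fun _ => 1, fun p => ⟨_, _, .const 1 p⟩, rfl⟩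
  add_mem' := by
    rintro _ _ ⟨f, hf, rfl⟩ ⟨f', hf', rfl⟩
    refine ⟨f + f', fun p => ?_, rfl⟩
    obtain ⟨g, h, H⟩ := hf p
    obtain ⟨g', h', H'⟩ := hf' p
    exact ⟨_, _, H.add H'⟩
  mul_mem' := by
    rintro _ _ ⟨f, hf, rfl⟩ ⟨f', hf', rfl⟩
    refine ⟨f * f', fun p => ?_, rfl⟩
    obtain ⟨g, h, H⟩ := hf p
    obtain ⟨g', h', H'⟩ := hf' p
    exact ⟨_, _, H.mul H'⟩
  neg_mem' := by
    rintro _ ⟨f, hf, rfl⟩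
    refine ⟨-f, fun p => ?_, rfl⟩
    obtain ⟨g, h, H⟩ := hf p
    exact ⟨_, _, H.neg⟩

/-- The field `𝔐(ℂⁿ)` of meromorphic functions on `ℂⁿ`. -/
def MeromorphicFunction (n : ℕ) : Type := meromorphicSubring n

namespace MeromorphicFunction

variable {n : ℕ}

instance : CommRing (MeromorphicFunction n) := inferInstanceAs (CommRing (meromorphicSubring n))

/-- The class of `f` modulo equality on dense open sets. -/
def toGerm (f : MeromorphicFunction n) : (denseOpenFilter n).Germ ℂ := f.1

/-- The meromorphic function represented by `f`. -/
def mk (f : (Fin n → ℂ) → ℂ) (hf : IsMeromorphicFun f) : MeromorphicFunction n :=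
  ⟨(f : (denseOpenFilter n).Germ ℂ), f, hf, rfl⟩

theorem inv_mem (f : MeromorphicFunction n) : f.toGerm⁻¹ ∈ meromorphicSubring n := by
  obtain ⟨_, f, hf, rfl⟩ := f
  by_cases f0 : f =ᶠ[denseOpenFilter n] 0
  · refine ⟨fun _ => 0, fun p => ⟨_, _, .const 0 p⟩, ?_⟩
    refine Germ.coe_eq.2 ?_
    filter_upwards [f0] with z hz
    simp [hz]
  · refine ⟨f⁻¹, fun p => ?_, rfl⟩
    obtain ⟨g, h, H⟩ := hf p
    exact ⟨_, _, H.inv (hf.num_ne_zero f0 H)⟩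

instance : Inv (MeromorphicFunction n) := ⟨fun f => ⟨f.toGerm⁻¹, f.inv_mem⟩⟩

theorem mul_inv_cancel' (f : MeromorphicFunction n) (h0 : f ≠ 0) : f * f⁻¹ = 1 := by
  obtain ⟨_, f, hf, rfl⟩ := f
  have f0 : ¬ f =ᶠ[denseOpenFilter n] 0 := fun h => h0 (Subtype.ext (Germ.coe_eq.2 h))
  refine Subtype.ext (Germ.coe_eq.2 ?_)
  refine eventually_denseOpenFilter fun p => ?_
  obtain ⟨g, h, H⟩ := hf p
  refine ⟨g * h, H.num.mul H.den,
    mul_not_eventuallyEq_zero H.num H.den (hf.num_ne_zero f0 H) H.den_ne, ?_⟩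
  filter_upwards [H.eq_div] with z hz hne
  obtain ⟨h1, h2⟩ := mul_ne_zero_iff.1 hne
  have hfz : f z ≠ 0 := by rw [hz h2]; exact div_ne_zero h1 h2
  exact mul_inv_cancel₀ hfz

instance : Field (MeromorphicFunction n) where
  exists_pair_ne := ⟨0, 1, fun h => zero_ne_one (α := (denseOpenFilter n).Germ ℂ)
    (congrArg Subtype.val h)⟩
  mul_inv_cancel := mul_inv_cancel'
  inv_zero := Subtype.ext (Germ.coe_eq.2 (Eventually.of_forall fun _ => inv_zero))
  nnqsmul := _
  nnqsmul_def _ _ := rfl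
  qsmul := _
  qsmul_def _ _ := rfl

/-- The complex numbers as constant meromorphic functions. -/
def constHom (n : ℕ) : ℂ →+* MeromorphicFunction n where
  toFun c := mk (fun _ => c) fun p => ⟨_, _, .const c p⟩
  map_zero' := rfl
  map_one' := rfl
  map_add' _ _ := rfl
  map_mul' _ _ := rfl

instance : Algebra ℂ (MeromorphicFunction n) := (constHom n).toAlgebra

end MeromorphicFunction

/-! ### Periods -/

theorem tendsto_add_denseOpenFilter {n : ℕ} (γ : Fin n → ℂ) :
    Tendsto (fun z => z + γ) (denseOpenFilter n) (denseOpenFilter n) := by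
  intro s hs
  rw [mem_map, mem_denseOpenFilter]
  have := (Homeomorph.addRight γ).preimage_interior s
  rw [mem_denseOpenFilter] at hs
  change Dense (interior ((Homeomorph.addRight γ) ⁻¹' s))
  rw [← this]
  exact hs.preimage (Homeomorph.addRight γ).isOpenMap

/-- The translateGerm `z ↦ f (z + γ)`. -/
def translateGerm {n : ℕ} (γ : Fin n → ℂ) (φ : (denseOpenFilter n).Germ ℂ) :
    (denseOpenFilter n).Germ ℂ :=
  φ.compTendsto (fun z => z + γ) (tendsto_add_denseOpenFilter γ)

theorem translateGerm_zero {n : ℕ} (φ : (denseOpenFilter n).Germ ℂ) : translateGerm 0 φ = φ := by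
  induction φ using Germ.inductionOn with | _ f => ?_
  simp [translateGerm, Germ.coe_compTendsto, Function.comp_def]

theorem translateGerm_add {n : ℕ} (γ δ : Fin n → ℂ) (φ : (denseOpenFilter n).Germ ℂ) :
    translateGerm (γ + δ) φ = translateGerm γ (translateGerm δ φ) := by
  induction φ using Germ.inductionOn with | _ f => ?_
  simp [translateGerm, Germ.coe_compTendsto, Function.comp_def, add_assoc]

/-- The period group `Γ_f` of a meromorphic function `f`: all `γ` with `f (z + γ) = f z`. -/
def MeromorphicFunction.periodGroup {n : ℕ} (f : MeromorphicFunction n) :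
    AddSubgroup (Fin n → ℂ) where
  carrier := {γ | translateGerm γ f.toGerm = f.toGerm}
  zero_mem' := translateGerm_zero _
  add_mem' {γ δ} hγ hδ := by
    simp only [Set.mem_ofPred_eq] at *
    rw [translateGerm_add, hδ, hγ]
  neg_mem' {γ} hγ := by
    simp only [Set.mem_ofPred_eq] at *
    conv_lhs => rw [← hγ]
    rw [← translateGerm_add, neg_add_cancel, translateGerm_zero]

/-- The period group `Γ_K` of a subfield `K`: the common periods of all `f ∈ K`. -/
def periodGroup {n : ℕ} (K : IntermediateField ℂ (MeromorphicFunction n)) :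
    AddSubgroup (Fin n → ℂ) :=
  ⨅ f ∈ K, f.periodGroup

/-- A meromorphic function is non-degenerate if its period group is discrete. -/
def MeromorphicFunction.IsNondegenerate {n : ℕ} (f : MeromorphicFunction n) : Prop :=
  DiscreteTopology f.periodGroup

/-- A subfield is non-degenerate if its period group is discrete. -/
def IsNondegenerate {n : ℕ} (K : IntermediateField ℂ (MeromorphicFunction n)) : Prop :=
  DiscreteTopology (periodGroup K)

/-- A subfield that contains a non-degenerate function is non-degenerate. -/
theorem MeromorphicFunction.IsNondegenerate.of_mem {n : ℕ} {f : MeromorphicFunction n}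
    (hf : f.IsNondegenerate) {K : IntermediateField ℂ (MeromorphicFunction n)} (hK : f ∈ K) :
    _root_.IsNondegenerate K :=
  DiscreteTopology.of_subset (s := (f.periodGroup : Set (Fin n → ℂ))) hf
    (show _root_.periodGroup K ≤ f.periodGroup from iInf₂_le f hK)

/-! ### The groups `ℂⁿ / Γ` and isogenies -/

/-- A function `u` on the open subset `U` of `ℂⁿ / Γ` is holomorphic if its pullback to `ℂⁿ` under
the canonical projection is holomorphic. For discrete `Γ` this is the complex structure of
`ℂⁿ / Γ`. -/
def HolomorphicOnQuotient {n : ℕ} (Γ : AddSubgroup (Fin n → ℂ)) (U : Set ((Fin n → ℂ) ⧸ Γ))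
    (u : (Fin n → ℂ) ⧸ Γ → ℂ) : Prop :=
  DifferentiableOn ℂ (fun z : Fin n → ℂ => u (z : (Fin n → ℂ) ⧸ Γ))
    ((fun z : Fin n → ℂ => (z : (Fin n → ℂ) ⧸ Γ)) ⁻¹' U)

/-- A mapping `ℂⁿ / Γ → ℂᵐ / Γ'` is holomorphic if it is continuous and pulls holomorphic functions
on open sets back to holomorphic functions. -/
def IsHolomorphicMap {n m : ℕ} (Γ : AddSubgroup (Fin n → ℂ)) (Γ' : AddSubgroup (Fin m → ℂ))
    (φ : (Fin n → ℂ) ⧸ Γ → (Fin m → ℂ) ⧸ Γ') : Prop :=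
  Continuous φ ∧ ∀ (U : Set ((Fin m → ℂ) ⧸ Γ')) (u : (Fin m → ℂ) ⧸ Γ' → ℂ), IsOpen U →
    HolomorphicOnQuotient Γ' U u → HolomorphicOnQuotient Γ (φ ⁻¹' U) (u ∘ φ)

/-- An isogeny between the connected commutative complex Lie groups `ℂⁿ / Γ` and `ℂᵐ / Γ'`
(with `Γ` and `Γ'` discrete): a surjective holomorphic group homomorphism with finite kernel. -/
structure IsIsogeny {n m : ℕ} {Γ : AddSubgroup (Fin n → ℂ)} {Γ' : AddSubgroup (Fin m → ℂ)}
    (φ : (Fin n → ℂ) ⧸ Γ →+ (Fin m → ℂ) ⧸ Γ') : Prop where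
  discrete_source : DiscreteTopology Γ
  discrete_target : DiscreteTopology Γ'
  holomorphic : IsHolomorphicMap Γ Γ' φ
  surjective : Function.Surjective φ
  finite_ker : Finite φ.ker

end

/-! ### Translations of meromorphic functions -/

/-! Since `K₂` is finitely generated, its transcendence degree is finite, so equality of degrees
makes `K₂` algebraic over `K₁` (`IntermediateField.isAlgebraic_of_trdeg_eq`). Translation by a
period of `K₁` is a field endomorphism fixing `K₁` pointwise, so it sends each `f ∈ K₂` to one of
the finitely many roots of the minimal polynomial of `f` over `K₁`
(`finite_translates_of_isAlgebraic`). Modulo the periods of `K₂`, a period of `K₁` is determined by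
the translates of finitely many generators of `K₂`, which leaves finitely many cosets
(`finite_periodGroup_quotient`). This quotient is the kernel of the map induced by the identity, and
discreteness passes to the smaller period group (`isIsogeny_map_id`). -/

theorem IsLocalQuotient.comp_add_right {n : ℕ} {f g h : (Fin n → ℂ) → ℂ} {p γ : Fin n → ℂ}
    (H : IsLocalQuotient f g h (p + γ)) :
    IsLocalQuotient (fun z => f (z + γ)) (fun z => g (z + γ)) (fun z => h (z + γ)) p := by
  have ht : Tendsto (fun z : Fin n → ℂ => z + γ) (𝓝 p) (𝓝 (p + γ)) :=
    (continuous_add_const γ).tendsto p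
  have ha : AnalyticAt ℂ (fun z : Fin n → ℂ => z + γ) p := analyticAt_id.add analyticAt_const
  refine ⟨H.num.comp_of_eq ha rfl, H.den.comp_of_eq ha rfl, fun h0 => H.den_ne ?_,
    ht.eventually H.eq_div⟩
  -- If the translated denominator vanished near `p`, shifting back by `-γ` would make `h` vanish
  -- near `p + γ`.
  have ht' : Tendsto (fun z : Fin n → ℂ => z + -γ) (𝓝 (p + γ)) (𝓝 p) := by
    simpa using (continuous_add_const (-γ)).tendsto (p + γ)
  filter_upwards [ht'.eventually h0] with z hz
  simpa using hz

theorem IsMeromorphicFun.comp_add_right {n : ℕ} {f : (Fin n → ℂ) → ℂ} (hf : IsMeromorphicFun f)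
    (γ : Fin n → ℂ) : IsMeromorphicFun fun z => f (z + γ) := fun p =>
  let ⟨_, _, H⟩ := hf (p + γ)
  ⟨_, _, H.comp_add_right⟩

theorem translateGerm_mem {n : ℕ} (γ : Fin n → ℂ) {φ : (denseOpenFilter n).Germ ℂ}
    (hφ : φ ∈ meromorphicSubring n) : translateGerm γ φ ∈ meromorphicSubring n := by
  obtain ⟨f, hf, rfl⟩ := hφ
  exact ⟨_, hf.comp_add_right γ, rfl⟩

namespace MeromorphicFunction

variable {n : ℕ}

theorem toGerm_injective : Function.Injective (toGerm (n := n)) := Subtype.val_injective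

/-- Translation by `γ` as an endomorphism of the field of meromorphic functions. -/
def translateHom (γ : Fin n → ℂ) : MeromorphicFunction n →ₐ[ℂ] MeromorphicFunction n where
  toFun f := ⟨translateGerm γ f.toGerm, translateGerm_mem γ f.2⟩
  map_one' := rfl
  map_zero' := rfl
  map_mul' := by
    rintro ⟨_, f, hf, rfl⟩ ⟨_, g, hg, rfl⟩
    rfl
  map_add' := by
    rintro ⟨_, f, hf, rfl⟩ ⟨_, g, hg, rfl⟩
    rfl
  commutes' _ := rfl

theorem translateHom_zero (f : MeromorphicFunction n) : translateHom 0 f = f :=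
  toGerm_injective (translateGerm_zero _)

theorem translateHom_add (γ δ : Fin n → ℂ) (f : MeromorphicFunction n) :
    translateHom (γ + δ) f = translateHom γ (translateHom δ f) :=
  toGerm_injective (translateGerm_add γ δ _)

theorem mem_periodGroup {f : MeromorphicFunction n} {γ : Fin n → ℂ} :
    γ ∈ f.periodGroup ↔ translateHom γ f = f :=
  toGerm_injective.eq_iff (a := translateHom γ f)

/-- Translates of `f` separate the cosets of its period group. The form `-γ + δ` is the one in which
`QuotientAddGroup.eq` expresses equality of cosets. -/
theorem neg_add_mem_periodGroup {f : MeromorphicFunction n} {γ δ : Fin n → ℂ}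
    (h : translateHom γ f = translateHom δ f) : -γ + δ ∈ f.periodGroup := by
  rw [mem_periodGroup, translateHom_add, ← h, ← translateHom_add, neg_add_cancel, translateHom_zero]

end MeromorphicFunction

open MeromorphicFunction (translateHom)

/-! ### Period groups of fields of meromorphic functions -/

section

variable {n : ℕ}

theorem mem_periodGroup {K : IntermediateField ℂ (MeromorphicFunction n)} {γ : Fin n → ℂ} :
    γ ∈ periodGroup K ↔ ∀ f ∈ K, translateHom γ f = f := by
  simp only [periodGroup, AddSubgroup.mem_iInf, MeromorphicFunction.mem_periodGroup]

theorem periodGroup_anti {K L : IntermediateField ℂ (MeromorphicFunction n)} (h : K ≤ L) :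
    periodGroup L ≤ periodGroup K :=
  fun _ hγ => mem_periodGroup.2 fun f hf => mem_periodGroup.1 hγ f (h hf)

/-- The functions fixed by a translation form a field containing `ℂ`, so generators suffice to test
a period. -/
theorem mem_periodGroup_adjoin {S : Set (MeromorphicFunction n)} {γ : Fin n → ℂ} :
    γ ∈ periodGroup (IntermediateField.adjoin ℂ S) ↔ ∀ f ∈ S, γ ∈ f.periodGroup := by
  simp only [mem_periodGroup, MeromorphicFunction.mem_periodGroup]
  refine ⟨fun h f hf => h f (IntermediateField.subset_adjoin _ _ hf), fun h f hf => ?_⟩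
  induction hf using IntermediateField.adjoin_induction with
  | mem f hf => exact h f hf
  | algebraMap c => exact (translateHom γ).commutes c
  | add f g _ _ hf hg => rw [map_add, hf, hg]
  | inv f _ hf => rw [map_inv₀, hf]
  | mul f g _ _ hf hg => rw [map_mul, hf, hg]

/-- A function algebraic over `K` has only finitely many translates by periods of `K`. -/
theorem finite_translates_of_isAlgebraic {K : IntermediateField ℂ (MeromorphicFunction n)}
    {f : MeromorphicFunction n} (hf : IsAlgebraic K f) :
    ((fun γ => translateHom γ f) '' (periodGroup K : Set (Fin n → ℂ))).Finite := by
  refine ((minpoly K f).rootSet_finite (MeromorphicFunction n)).subset ?_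
  rintro _ ⟨γ, hγ, rfl⟩
  -- Because `γ` is a period of `K`, translation by it is `K`-linear and therefore maps roots of
  -- `minpoly K f` to roots.
  let τ : MeromorphicFunction n →ₐ[K] MeromorphicFunction n :=
    { (translateHom γ : MeromorphicFunction n →+* MeromorphicFunction n) with
      commutes' := fun k => mem_periodGroup.1 hγ k k.2 }
  refine (Polynomial.mem_rootSet_of_ne (minpoly.ne_zero hf.isIntegral)).2 ?_
  change Polynomial.aeval (τ f) (minpoly K f) = 0
  rw [Polynomial.aeval_algHom_apply, minpoly.aeval, map_zero]

/-- If `L` is finitely generated and algebraic over `K`, then the periods of `L` have finite index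
in the periods of `K`. -/
theorem finite_periodGroup_quotient {K L : IntermediateField ℂ (MeromorphicFunction n)}
    (hL : L.FG) (halg : ∀ f ∈ L, IsAlgebraic K f) :
    Finite (periodGroup K ⧸ (periodGroup L).addSubgroupOf (periodGroup K)) := by
  obtain ⟨S, rfl⟩ := hL
  have hfin (s : S) := (finite_translates_of_isAlgebraic
    (halg s (IntermediateField.subset_adjoin _ _ s.2))).to_subtype
  -- `F γ` records the translates by `γ` of all generators. Its codomain is a finite product of
  -- finite sets.
  let F : periodGroup K → ∀ s : S,
      (fun γ => translateHom γ (s : MeromorphicFunction n)) '' (periodGroup K : Set (Fin n → ℂ)) :=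
    fun γ s => ⟨translateHom γ s, γ, γ.2, rfl⟩
  have key : Function.Injective fun q : periodGroup K ⧸
      (periodGroup (IntermediateField.adjoin ℂ (S : Set (MeromorphicFunction n)))).addSubgroupOf
        (periodGroup K) => F q.out := by
    intro a b hab
    rw [← QuotientAddGroup.out_eq' a, ← QuotientAddGroup.out_eq' b, QuotientAddGroup.eq,
      AddSubgroup.mem_addSubgroupOf, mem_periodGroup_adjoin]
    intro f hf
    exact MeromorphicFunction.neg_add_mem_periodGroup (congrArg Subtype.val (congrFun hab ⟨f, hf⟩))
  exact Finite.of_injective _ key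

end

/-- Comparable finitely generated fields of the same transcendence degree form an algebraic
extension. -/
theorem IntermediateField.isAlgebraic_of_trdeg_eq {F E : Type*} [Field F] [Field E] [Algebra F E]
    {K L : IntermediateField F E} (hle : K ≤ L) (hL : L.FG)
    (h : Algebra.trdeg F K = Algebra.trdeg F L) {x : E} (hx : x ∈ L) : IsAlgebraic K x := by
  have : Algebra.EssFiniteType F L := essFiniteType_iff.2 hL
  have : FaithfulSMul K (extendScalars hle) :=
    (faithfulSMul_iff_algebraMap_injective _ _).2 (algebraMap K (extendScalars hle)).injective
  have hadd : Algebra.trdeg F K + Algebra.trdeg K (extendScalars hle) = Algebra.trdeg F L :=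
    trdeg_add_eq F K (A := extendScalars hle)
  have h0 : Algebra.trdeg K (extendScalars hle) = 0 := by
    -- Cancelling `a + b = a` requires `a` to be a finite cardinal; this is where finite generation
    -- of `L` enters.
    refine Cardinal.eq_of_add_eq_add_left (a := Algebra.trdeg F K) ?_ (h ▸ trdeg_lt_aleph0 F L)
    rw [hadd, h, add_zero]
  have := trdeg_eq_zero_iff.1 h0
  exact (Algebra.IsAlgebraic.isAlgebraic (R := K) (⟨x, hx⟩ : extendScalars hle)).algebraMap

/-! ### The isogeny induced by the identity -/

theorem isIsogeny_map_id {n : ℕ} {Γ Γ' : AddSubgroup (Fin n → ℂ)} (hle : Γ ≤ Γ')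
    (hd : DiscreteTopology Γ') (hfin : Finite (Γ' ⧸ Γ.addSubgroupOf Γ')) :
    IsIsogeny (QuotientAddGroup.map Γ Γ' (AddMonoidHom.id _) hle) where
  discrete_source := DiscreteTopology.of_subset (s := (Γ' : Set (Fin n → ℂ))) hd hle
  discrete_target := hd
  holomorphic :=
    -- The map lifts to the identity of `ℂⁿ`, so `u` and its pullback along the map are represented
    -- by the same function on the same open set.
    ⟨continuous_quot_lift _ QuotientAddGroup.continuous_mk, fun _ _ _ hu => hu⟩
  surjective := by
    rintro ⟨z⟩
    exact ⟨z, rfl⟩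
  finite_ker := by
    -- The kernel is `Γ' / Γ`. Finiteness needs only a surjection onto it, so arbitrary
    -- representatives serve and no isomorphism of groups has to be built.
    let F : Γ' ⧸ Γ.addSubgroupOf Γ' → (QuotientAddGroup.map Γ Γ' (AddMonoidHom.id _) hle).ker :=
      fun q => ⟨(q.out : Fin n → ℂ), (QuotientAddGroup.eq_zero_iff _).2 q.out.2⟩
    refine Finite.of_surjective F ?_
    rintro ⟨⟨z⟩, hz⟩
    have hz' : z ∈ Γ' := (QuotientAddGroup.eq_zero_iff z).1 hz
    refine ⟨((⟨z, hz'⟩ : Γ') : Γ' ⧸ Γ.addSubgroupOf Γ'), Subtype.ext ?_⟩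
    -- The chosen representative of the class of `z` differs from `z` by an element of `Γ`, so both
    -- give the same point of `ℂⁿ / Γ`.
    have h := QuotientAddGroup.eq.1 (QuotientAddGroup.out_eq' (((⟨z, hz'⟩ : Γ') :
      Γ' ⧸ Γ.addSubgroupOf Γ')))
    exact QuotientAddGroup.eq.2 h

theorem proposition3 (n : ℕ) (K₁ K₂ : IntermediateField ℂ (MeromorphicFunction n))
    (hfg₁ : K₁.FG) (hfg₂ : K₂.FG) (hnd : IsNondegenerate K₁) (hle : K₁ ≤ K₂)
    (htr : Algebra.trdeg ℂ K₁ = Algebra.trdeg ℂ K₂) :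
    periodGroup K₂ ≤ periodGroup K₁ ∧
    (∃ φ : (Fin n → ℂ) ⧸ periodGroup K₂ →+ (Fin n → ℂ) ⧸ periodGroup K₁,
      (∀ z : Fin n → ℂ, φ (z : (Fin n → ℂ) ⧸ periodGroup K₂) =
        (z : (Fin n → ℂ) ⧸ periodGroup K₁)) ∧
      IsIsogeny φ) ∧
    Finite (periodGroup K₁ ⧸ (periodGroup K₂).addSubgroupOf (periodGroup K₁)) := by
  have hfin := finite_periodGroup_quotient hfg₂
    fun _ hf => IntermediateField.isAlgebraic_of_trdeg_eq hle hfg₂ htr hf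
  exact ⟨periodGroup_anti hle, ⟨_, fun _ => rfl, isIsogeny_map_id (periodGroup_anti hle) hnd hfin⟩,
    hfin⟩
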